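/- Let $R$ be a domain with quotient field $K$ and complete integral closure $\widehat R=\{x\in K : \text{there is } 0\neq c\in R \text{ with } cx^n\in R \text{ for all } n\in\mathbb N\}$, and suppose that the conductor $(R:\widehat R)=\{x\in K : x\widehat R\subset R\}$ is nonzero. Let $r$ be an ideal system on $R$, i.e. a map $X\mapsto X_r$ on the subsets of $R$ such that $X\cup\{0\}\subset X_r$, $cR\subset\{c\}_r$, $cX_r=(cX)_r$, and $X\subset Y_r$ implies $X_r\subset Y_r$, for all $X,Y\subset R$ and $c\in R$; assume (as for all ideal systems considered here) that every $r$-ideal, i.e. every $I\subset R$ with $I_r=I$, is a ring ideal of $R$. Let $\mathcal I_r(R)$ be the semigroup of nonzero $r$-ideals with multiplication $I\cdot_r J=(IJ)_r$ and identity $R$, let $\mathcal A(\mathcal I_r(R))$ be its set of atoms (irreducible elements), let $r\text{-}\max(R)$ be the set of maximal elements of $\mathcal I_r(R)\setminus\{R\}$ with respect to inclusion, and let $\mathfrak X(R)$ be the set of minimal nonzero prime ideals (height-one primes) of $R$. Suppose that $R$ is $r$-Noetherian (the $r$-ideals satisfy the ascending chain condition) and that $r\text{-}\max(R)=\mathfrak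 X(R)$. Set $$\mathcal P=\{\mathfrak p\in\mathfrak X(R) : \mathfrak p\not\supset(R:\widehat R)\},\qquad \mathcal P^*=\mathfrak X(R)\setminus\mathcal P,$$ and let $T$ be the subsemigroup with identity of $\mathcal I_r(R)$ generated by $\{I\in\mathcal A(\mathcal I_r(R)) : \sqrt I\in\mathcal P^*\}$. Then: 1. $T$ is unit-cancellative (that is, $a,u\in T$ and $a=a\cdot_r u$ imply that $u$ is invertible in $T$), and $\mathcal I_r(R)\cong\mathcal F(\mathcal P)\times T$ as semigroups with identity, where $\mathcal F(\mathcal P)$ is the free abelian monoid with basis $\mathcal P$. 2. $T$ is finitely generated if and only if the set $\{I\in\mathcal A(\mathcal I_r(R)) : \sqrt I\in\mathcal P^*\}$ is finite. -/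

import Mathlib

open scoped Pointwise

/-- The conductor `(R : R̂)` of a domain `R` in its complete integral closure `R̂`, taken in the
quotient field. As `1 ∈ R̂`, it is contained in `R`, and it is an ideal of `R`. -/
def completeConductor (R : Type*) [CommRing R] [IsDomain R] : Ideal R where
  carrier := {a : R | ∀ x ∈ completeIntegralClosure R (FractionRing R),
    algebraMap R (FractionRing R) a * x ∈ (algebraMap R (FractionRing R)).range}
  add_mem' := by
    intro a b ha hb x hx
    rw [map_add, add_mul]
    exact add_mem (ha x hx) (hb x hx)
  zero_mem' := by
    intro x _
    rw [map_zero, zero_mul]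
    exact zero_mem _
  smul_mem' := by
    intro c a ha x hx
    rw [smul_eq_mul, map_mul, mul_assoc]
    exact mul_mem ⟨c, rfl⟩ (ha x hx)

/-- `𝔛(R)`: the set of minimal nonzero prime ideals (height-one primes) of `R`. -/
def minimalNonzeroPrimes (R : Type*) [CommRing R] : Set (Ideal R) :=
  {p | Minimal (fun q : Ideal R => q.IsPrime ∧ q ≠ ⊥) p}

/-- `𝒫`: the height-one primes of `R` that do not contain the conductor `(R : R̂)`. -/
def regularPrimes (R : Type*) [CommRing R] [IsDomain R] : Set (Ideal R) :=
  {p | p ∈ minimalNonzeroPrimes R ∧ ¬ completeConductor R ≤ p}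

/-- `𝒫* = 𝔛(R) ∖ 𝒫`: the height-one primes of `R` that contain the conductor `(R : R̂)`. -/
def singularPrimes (R : Type*) [CommRing R] [IsDomain R] : Set (Ideal R) :=
  minimalNonzeroPrimes R \ regularPrimes R

/-- An ideal system `X ↦ X_r` on `R` all of whose `r`-ideals are ring ideals. As every `X_r` is an
`r`-ideal, the latter condition says exactly that the operation `X ↦ X_r` takes values in the ring
ideals of `R`. (That `0 ∈ X_r` is then automatic.) -/
structure IdealSystem (R : Type*) [CommRing R] where
  /-- the ideal `X_r` attached to the subset `X` of `R` -/
  cl : Set R → Ideal R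
  subset_cl : ∀ X : Set R, X ⊆ cl X
  cl_subset_cl : ∀ X Y : Set R, X ⊆ cl Y → (cl X : Set R) ⊆ cl Y
  mul_mem_cl_singleton : ∀ c a : R, c * a ∈ cl {c}
  mul_cl : ∀ (c : R) (X : Set R),
    (fun x => c * x) '' (cl X : Set R) = (cl ((fun x => c * x) '' X) : Set R)

namespace IdealSystem

variable {R : Type*} [CommRing R]

/-- `I` is an `r`-ideal, that is, `I_r = I`. -/
def IsRIdeal (r : IdealSystem R) (I : Ideal R) : Prop :=
  r.cl (I : Set R) = I

/-- `R` is `r`-Noetherian: every ascending chain of `r`-ideals becomes stationary. -/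
def IsRNoetherian (r : IdealSystem R) : Prop :=
  ∀ f : ℕ → Ideal R, Monotone f → (∀ n, r.IsRIdeal (f n)) → ∃ n, ∀ m, n ≤ m → f m = f n

/-- `r-max(R)`: the set of maximal elements among the nonzero proper `r`-ideals. -/
def rMax (r : IdealSystem R) : Set (Ideal R) :=
  {M | Maximal (fun I : Ideal R => r.IsRIdeal I ∧ I ≠ ⊥ ∧ I ≠ ⊤) M}

/-- The underlying set of `𝓘_r(R)`: the nonzero `r`-ideals of `R`. -/
def NonzeroRIdeal (r : IdealSystem R) : Type _ :=
  {I : Ideal R // r.IsRIdeal I ∧ I ≠ ⊥}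

theorem cl_mono (r : IdealSystem R) {X Y : Set R} (h : X ⊆ Y) :
    (r.cl X : Set R) ⊆ r.cl Y :=
  r.cl_subset_cl X Y (h.trans (r.subset_cl Y))

theorem isRIdeal_cl (r : IdealSystem R) (X : Set R) : r.IsRIdeal (r.cl X) :=
  SetLike.coe_injective
    (Set.Subset.antisymm (r.cl_subset_cl _ _ subset_rfl) (r.subset_cl _))

theorem isRIdeal_top (r : IdealSystem R) : r.IsRIdeal ⊤ :=
  top_le_iff.1 (r.subset_cl _)

theorem cl_cl_mul (r : IdealSystem R) (X Y : Set R) :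
    r.cl ((r.cl X : Set R) * Y) = r.cl (X * Y) := by
  apply SetLike.coe_injective
  apply Set.Subset.antisymm
  · apply r.cl_subset_cl
    rintro _ ⟨x, hx, y, hy, rfl⟩
    have h : y * x ∈ (r.cl ((fun z => y * z) '' X) : Set R) := by
      rw [← r.mul_cl]
      exact ⟨x, hx, rfl⟩
    have h' : (fun z => y * z) '' X ⊆ X * Y := by
      rintro _ ⟨z, hz, rfl⟩
      exact ⟨z, hz, y, hy, mul_comm z y⟩
    have h'' : y * x ∈ r.cl (X * Y) := r.cl_mono h' h
    rw [mul_comm y x] at h''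
    exact h''
  · exact r.cl_mono (Set.mul_subset_mul_right (r.subset_cl X))

/-- `𝓘_r(R)` is a commutative semigroup with identity `R` under `r`-multiplication
`I ·_r J = (IJ)_r`, where `IJ = {ab ∣ a ∈ I, b ∈ J}`. -/
instance [IsDomain R] (r : IdealSystem R) : CommMonoid r.NonzeroRIdeal where
  mul I J := ⟨r.cl ((I.1 : Set R) * (J.1 : Set R)), r.isRIdeal_cl _, by
    obtain ⟨a, ha, ha0⟩ := Submodule.exists_mem_ne_zero_of_ne_bot I.2.2
    obtain ⟨b, hb, hb0⟩ := Submodule.exists_mem_ne_zero_of_ne_bot J.2.2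
    have h : a * b ∈ r.cl ((I.1 : Set R) * (J.1 : Set R)) :=
      r.subset_cl _ (Set.mul_mem_mul ha hb)
    intro h0
    rw [h0, Ideal.mem_bot] at h
    exact mul_ne_zero ha0 hb0 h⟩
  one := ⟨⊤, r.isRIdeal_top, top_ne_bot⟩
  mul_comm I J := Subtype.ext (congrArg r.cl (mul_comm (I.1 : Set R) (J.1 : Set R)))
  mul_assoc I J K := by
    apply Subtype.ext
    change r.cl ((r.cl ((I.1 : Set R) * (J.1 : Set R)) : Set R) * (K.1 : Set R)) =
      r.cl ((I.1 : Set R) * (r.cl ((J.1 : Set R) * (K.1 : Set R)) : Set R))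
    rw [cl_cl_mul, mul_comm (I.1 : Set R) (r.cl _ : Set R), cl_cl_mul,
      mul_comm _ (I.1 : Set R), mul_assoc]
  one_mul I := by
    apply Subtype.ext
    change r.cl (((⊤ : Ideal R) : Set R) * (I.1 : Set R)) = I.1
    have h : ((⊤ : Ideal R) : Set R) * (I.1 : Set R) = (I.1 : Set R) := by
      apply Set.Subset.antisymm
      · rintro _ ⟨a, _, b, hb, rfl⟩
        exact I.1.mul_mem_left a hb
      · intro b hb
        exact ⟨1, Submodule.mem_top, b, hb, one_mul b⟩
    rw [h]
    exact I.2.1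
  mul_one I := by
    apply Subtype.ext
    change r.cl ((I.1 : Set R) * ((⊤ : Ideal R) : Set R)) = I.1
    have h : (I.1 : Set R) * ((⊤ : Ideal R) : Set R) = (I.1 : Set R) := by
      apply Set.Subset.antisymm
      · rintro _ ⟨b, hb, a, _, rfl⟩
        exact I.1.mul_mem_right a hb
      · intro b hb
        exact ⟨b, hb, 1, Submodule.mem_top, mul_one b⟩
    rw [h]
    exact I.2.1

/-- `{I ∈ 𝒜(𝓘_r(R)) ∣ √I ∈ 𝒫*}`: the atoms of `𝓘_r(R)` whose radical lies in `𝒫*`. -/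
def singularAtoms [IsDomain R] (r : IdealSystem R) : Set r.NonzeroRIdeal :=
  {I | Irreducible I ∧ I.1.radical ∈ singularPrimes R}

/-- `T`: the subsemigroup (with identity) of `𝓘_r(R)` generated by the atoms whose radical lies
in `𝒫*`. -/
def singularPart [IsDomain R] (r : IdealSystem R) : Submonoid r.NonzeroRIdeal :=
  Submonoid.closure r.singularAtoms

end IdealSystem

/-- A commutative semigroup with identity is unit-cancellative if `a = a * u` implies that `u` is
invertible. -/
def IsUnitCancellative (H : Type*) [CommMonoid H] : Prop :=
  ∀ a u : H, a = a * u → IsUnit u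

/-!
The monoid of nonzero `r`-ideals is reduced, and three facts determine its arithmetic.

* It is unit-cancellative (`IdealSystem.eq_one_of_eq_mul`). Suppose `I = (IJ)_r` with `J` contained
  in a height-one prime `p`. Noetherian induction shows that for every nonzero `r`-ideal `A` there
  is `s ∉ p` with `sI ⊆ (AI)_r`: enlarge `A` to `(A ∪ {y})_r`, where `p = (A : y)`, and use
  `yJ ⊆ A` to return to `A`. For `A = aR` this says that `s / a` maps `I` to itself, so `s / a` is
  almost integral. Taking `a = fc` with `f` in the conductor and `c ∈ p` gives `s ∈ cR ⊆ p`, a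
  contradiction. Together with the ascending chain condition, this makes the monoid atomic.
* The `r`-ideals `p ∈ 𝒫` are prime elements and cancel. If `p = (aR : y)`, then `y / a` does not
  map `p` to itself, as it would otherwise be almost integral, and hence `p` is locally principal
  at `p`; this makes `p` a divisor of a nonzero principal ideal
  (`IdealSystem.exists_mul_eq_principal`).
* Every atom has radical of height one (`IdealSystem.radical_mem_of_irreducible`), because the
  primary component `Q` of `I` at a height-one prime is an `r`-ideal and `I = (Q (I : Q))_r`.

So the atoms are the elements of `𝒫` and the atoms generating `T`. Elements of `T` are not
divisible by any `p ∈ 𝒫`, which gives the direct product decomposition. Finally, in a reduced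
monoid the atoms belong to every generating set.
-/

/-! ### Generating sets and prime factors in commutative monoids -/

/-- In a reduced monoid, an irreducible element belongs to every generating set. -/
theorem Irreducible.mem_of_closure_eq_top {M : Type*} [CommMonoid M]
    (hu : ∀ u : M, IsUnit u → u = 1) {S : Set M} (hS : Submonoid.closure S = ⊤) {a : M}
    (ha : Irreducible a) : a ∈ S := by
  have key : ∀ x ∈ Submonoid.closure S, Irreducible x → x ∈ S := by
    intro x hx
    induction hx using Submonoid.closure_induction with
    | mem x hx => exact fun _ => hx
    | one => exact fun h => absurd isUnit_one h.not_isUnit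
    | mul x y _ _ ihx ihy =>
      intro h
      rcases h.isUnit_or_isUnit rfl with hx | hy
      · rw [hu x hx, one_mul] at h ⊢
        exact ihy h
      · rw [hu y hy, mul_one] at h ⊢
        exact ihx h
  exact key a (hS ▸ Submonoid.mem_top a) ha

/-- If the `e i` are cancellable prime elements, none of which divides another, and no element of
the submonoid `T` is divisible by some `e i`, then factorizations into elements `e i` and one
element of `T` are unique. -/
theorem Multiset.injective_prod_map_mul {M ι : Type*} [CommMonoid M] (e : ι → M)
    (T : Submonoid M) (hcancel : ∀ i a b, e i * a = e i * b → a = b)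
    (hprime : ∀ i a b, e i ∣ a * b → e i ∣ a ∨ e i ∣ b) (he : ∀ i j, e i ∣ e j → i = j)
    (hT : ∀ i, ∀ t ∈ T, ¬ e i ∣ t) :
    Function.Injective fun x : Multiset ι × T => (x.1.map e).prod * (x.2 : M) := by
  have mem_of_dvd : ∀ (i : ι) (n : Multiset ι) (t : T), e i ∣ (n.map e).prod * t → i ∈ n := by
    intro i n t
    induction n using Multiset.induction_on with
    | empty =>
      intro h
      rw [Multiset.map_zero, Multiset.prod_zero, one_mul] at h
      exact absurd h (hT i t t.2)
    | cons j n ih =>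
      intro h
      rw [Multiset.map_cons, Multiset.prod_cons, mul_assoc] at h
      rcases hprime _ _ _ h with h | h
      · exact he i j h ▸ Multiset.mem_cons_self _ _
      · exact Multiset.mem_cons_of_mem (ih h)
  rintro ⟨m, s⟩ ⟨n, t⟩ h
  simp only at h
  induction m using Multiset.induction_on generalizing n with
  | empty =>
    induction n using Multiset.induction_on with
    | empty =>
      rw [Multiset.map_zero, Multiset.prod_zero, one_mul, one_mul] at h
      rw [Subtype.ext h]
    | cons j n _ =>
      refine absurd ?_ (hT j s s.2)
      rw [Multiset.map_zero, Multiset.prod_zero, one_mul, Multiset.map_cons,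
        Multiset.prod_cons, mul_assoc] at h
      exact ⟨_, h⟩
  | cons i m ih =>
    rw [Multiset.map_cons, Multiset.prod_cons, mul_assoc] at h
    obtain ⟨n, rfl⟩ := Multiset.exists_cons_of_mem (mem_of_dvd i n t ⟨_, h.symm⟩)
    rw [Multiset.map_cons, Multiset.prod_cons, mul_assoc] at h
    have := ih n (hcancel _ _ _ h)
    simp only [Prod.mk.injEq] at this ⊢
    exact ⟨by rw [this.1], this.2⟩

/-! ### The conductor -/

/-- If multiplication by `s / a` maps a nonzero ideal to itself, then `s / a` is almost integral,
so that the elements of the conductor multiply it into `R`. -/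
theorem dvd_mul_of_mem_completeConductor {R : Type*} [CommRing R] [IsDomain R] {I : Ideal R}
    (hI : I ≠ ⊥) {a s f : R} (ha : a ≠ 0) (h : ∀ x ∈ I, ∃ y ∈ I, s * x = a * y)
    (hf : f ∈ completeConductor R) : a ∣ f * s := by
  let φ := algebraMap R (FractionRing R)
  have ha' : φ a ≠ 0 :=
    (map_ne_zero_iff φ (IsFractionRing.injective R (FractionRing R))).2 ha
  obtain ⟨i, hi, hi0⟩ := Submodule.exists_mem_ne_zero_of_ne_bot hI
  have hpow : ∀ n : ℕ, ∃ y ∈ I, s ^ n * i = a ^ n * y := by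
    intro n
    induction n with
    | zero => exact ⟨i, hi, by simp⟩
    | succ n ih =>
      obtain ⟨y, hy, hy'⟩ := ih
      obtain ⟨z, hz, hz'⟩ := h y hy
      refine ⟨z, hz, ?_⟩
      calc s ^ (n + 1) * i = s * (s ^ n * i) := by ring
        _ = a ^ n * (s * y) := by rw [hy']; ring
        _ = a ^ (n + 1) * z := by rw [hz']; ring
  have hmem : φ s / φ a ∈ completeIntegralClosure R (FractionRing R) := by
    refine ⟨i, mem_nonZeroDivisors_of_ne_zero hi0, fun n => ?_⟩
    obtain ⟨y, _, hy⟩ := hpow n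
    refine ⟨y, ?_⟩
    have h1 : φ s ^ n * φ i = φ a ^ n * φ y := by
      rw [← map_pow, ← map_pow, ← map_mul, ← map_mul, hy]
    rw [Algebra.smul_def, div_pow, mul_div_assoc', eq_div_iff (pow_ne_zero _ ha')]
    change φ y * _ = φ i * _
    rw [mul_comm, ← h1, mul_comm]
  obtain ⟨x, hx⟩ := hf _ hmem
  refine ⟨x, IsFractionRing.injective R (FractionRing R) ?_⟩
  change φ x = φ f * _ at hx
  change φ _ = φ _
  rw [map_mul, map_mul, hx]
  field_simp

namespace IdealSystem

variable {R : Type*} [CommRing R]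

/-! ### Closures, colon ideals and maximal `r`-ideals -/

theorem mem_cl (r : IdealSystem R) {X : Set R} {x : R} (hx : x ∈ X) : x ∈ r.cl X :=
  r.subset_cl X hx

theorem cl_le (r : IdealSystem R) {X : Set R} {I : Ideal R} (hI : r.IsRIdeal I)
    (h : X ⊆ I) : r.cl X ≤ I := by
  intro x hx
  rw [← hI]
  exact r.cl_mono h hx

theorem isRIdeal_of_le {r : IdealSystem R} {I : Ideal R} (h : r.cl (I : Set R) ≤ I) :
    r.IsRIdeal I :=
  le_antisymm h (r.subset_cl _)

theorem mul_mem_cl_image (r : IdealSystem R) (c : R) {X : Set R} {x : R} (hx : x ∈ r.cl X) :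
    c * x ∈ r.cl ((fun z => c * z) '' X) := by
  have h : c * x ∈ (fun z => c * z) '' (r.cl X : Set R) := ⟨x, hx, rfl⟩
  rwa [r.mul_cl] at h

theorem isRIdeal_colon {r : IdealSystem R} {I : Ideal R} (hI : r.IsRIdeal I) (Y : Set R) :
    r.IsRIdeal (I.colon Y) := by
  refine isRIdeal_of_le fun x hx => Submodule.mem_colon.2 fun y hy => ?_
  rw [smul_eq_mul, mul_comm]
  refine r.cl_le hI ?_ (r.mul_mem_cl_image y hx)
  rintro _ ⟨z, hz, rfl⟩
  have h : z * y ∈ I := Submodule.mem_colon.1 hz y hy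
  rwa [mul_comm] at h

theorem isRIdeal_span_singleton (r : IdealSystem R) (a : R) :
    r.IsRIdeal (Ideal.span {a}) := by
  have h : Ideal.span {a} = r.cl ((fun z => a * z) '' (Set.univ : Set R)) := by
    apply SetLike.coe_injective
    rw [← r.mul_cl]
    ext x
    constructor
    · intro hx
      obtain ⟨y, rfl⟩ := Ideal.mem_span_singleton.1 hx
      exact ⟨y, r.mem_cl (Set.mem_univ y), rfl⟩
    · rintro ⟨y, _, rfl⟩
      exact Ideal.mem_span_singleton.2 (dvd_mul_right a y)
  rw [h]
  exact r.isRIdeal_cl _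

theorem IsRNoetherian.exists_maximal {r : IdealSystem R} (hr : r.IsRNoetherian)
    {C : Ideal R → Prop} (hC : ∀ I, C I → r.IsRIdeal I) {I : Ideal R} (hI : C I) :
    ∃ J, Maximal C J := by
  have hwf : WellFoundedGT {I : Ideal R // r.IsRIdeal I} := by
    rw [wellFoundedGT_iff_monotone_chain_condition]
    intro f
    obtain ⟨n, hn⟩ := hr (fun k => (f k).1) (fun _ _ h => f.monotone h) fun k => (f k).2
    exact ⟨n, fun m hm => Subtype.ext (hn m hm).symm⟩
  obtain ⟨J, hJ, hmax⟩ := hwf.wf.has_min {J : {I : Ideal R // r.IsRIdeal I} | C J.1}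
    ⟨⟨I, hC I hI⟩, hI⟩
  exact ⟨J.1, maximal_iff_forall_gt.2 ⟨hJ, fun L hlt hL => hmax ⟨L, hC L hL⟩ hL hlt⟩⟩

theorem eq_top_of_forall_rMax {r : IdealSystem R} (hr : r.IsRNoetherian) {I : Ideal R}
    (hI : r.IsRIdeal I) (hI0 : I ≠ ⊥) (h : ∀ p ∈ r.rMax, ¬ I ≤ p) : I = ⊤ := by
  by_contra hI1
  obtain ⟨M, hM⟩ := hr.exists_maximal
    (C := fun J => (r.IsRIdeal J ∧ J ≠ ⊥ ∧ J ≠ ⊤) ∧ I ≤ J) (fun J hJ => hJ.1.1)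
    ⟨⟨hI, hI0, hI1⟩, le_rfl⟩
  exact h M ⟨hM.1.1, fun J hJ hle => hM.2 ⟨hJ, hM.1.2.trans hle⟩ hle⟩ hM.1.2

theorem eq_of_le_of_mem_minimalNonzeroPrimes {p q : Ideal R} (hp : p ∈ minimalNonzeroPrimes R)
    (hq : q ∈ minimalNonzeroPrimes R) (h : p ≤ q) : p = q :=
  le_antisymm h (hq.2 hp.1 h)

theorem isRIdeal_of_mem_minimalNonzeroPrimes {r : IdealSystem R}
    (hmax : r.rMax = minimalNonzeroPrimes R) {p : Ideal R} (hp : p ∈ minimalNonzeroPrimes R) :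
    r.IsRIdeal p := by
  rw [← hmax] at hp
  exact hp.1.1

/-- A height-one prime containing a nonzero `r`-ideal `A` is of the form `(A : y)`: among the
ideals `(A : y)` contained in `p`, a maximal one is prime. -/
theorem exists_mem_iff_mul_mem {r : IdealSystem R} (hr : r.IsRNoetherian) {A p : Ideal R}
    (hA : r.IsRIdeal A) (hA0 : A ≠ ⊥) (hp : p ∈ minimalNonzeroPrimes R) (hAp : A ≤ p) :
    ∃ y, ∀ z, z ∈ p ↔ z * y ∈ A := by
  have hpp : p.IsPrime := hp.1.1
  obtain ⟨_, ⟨⟨y, rfl⟩, hyp⟩, hmax⟩ := hr.exists_maximal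
    (C := fun J => (∃ y, J = A.colon {y}) ∧ J ≤ p)
    (by rintro _ ⟨⟨y, rfl⟩, _⟩; exact isRIdeal_colon hA _)
    (I := A.colon {1})
    ⟨⟨1, rfl⟩, fun x hx => hAp (by simpa using hx)⟩
  have mem_colon {x y : R} : x ∈ A.colon {y} ↔ x * y ∈ A := by
    rw [Submodule.mem_colon_singleton, smul_eq_mul]
  have hprime : (A.colon {y}).IsPrime := by
    refine ⟨fun h => hpp.ne_top (top_le_iff.1 (h ▸ hyp)), fun {a b} hab => ?_⟩
    by_cases hle : A.colon {a * y} ≤ p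
    · right
      refine hmax ⟨⟨_, rfl⟩, hle⟩ (fun x hx => ?_) (?_ : b ∈ A.colon {a * y})
      · rw [mem_colon] at hx ⊢
        rw [mul_left_comm]
        exact A.mul_mem_left a hx
      · rw [mem_colon] at hab ⊢
        rwa [← mul_assoc, mul_comm b a]
    · left
      obtain ⟨t, ht, htp⟩ := SetLike.not_le_iff_exists.1 hle
      have hle' : A.colon {t * y} ≤ p := by
        intro x hx
        rw [mem_colon, ← mul_assoc, ← mem_colon] at hx
        exact (hpp.mem_or_mem (hyp hx)).resolve_right htp
      refine hmax ⟨⟨_, rfl⟩, hle'⟩ (fun x hx => ?_) (?_ : a ∈ A.colon {t * y})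
      · rw [mem_colon] at hx ⊢
        rw [mul_left_comm]
        exact A.mul_mem_left t hx
      · rw [mem_colon] at ht ⊢
        rwa [mul_left_comm]
  have hne : A.colon {y} ≠ ⊥ := by
    obtain ⟨a, ha, ha0⟩ := Submodule.exists_mem_ne_zero_of_ne_bot hA0
    refine (Submodule.ne_bot_iff _).2 ⟨a, mem_colon.2 (A.mul_mem_right y ha), ha0⟩
  have heq : A.colon {y} = p := le_antisymm hyp (hp.2 ⟨hprime, hne⟩ hyp)
  exact ⟨y, fun z => by rw [← mem_colon, heq]⟩

/-- The component of `A` at a prime `p`, i.e. the contraction of `A` localized at `p`, is of the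
form `(A : s)` with a single `s ∉ p`. -/
theorem exists_forall_mul_mem {r : IdealSystem R} (hr : r.IsRNoetherian) {A p : Ideal R}
    (hA : r.IsRIdeal A) (hp : p.IsPrime) :
    ∃ s ∉ p, ∀ t ∉ p, ∀ x, t * x ∈ A → s * x ∈ A := by
  obtain ⟨_, ⟨s, hs, rfl⟩, hmax⟩ := hr.exists_maximal
    (C := fun J => ∃ s ∉ p, J = A.colon {s})
    (by rintro _ ⟨s, _, rfl⟩; exact isRIdeal_colon hA _)
    (I := A.colon {1}) ⟨1, fun h => hp.ne_top ((Ideal.eq_top_iff_one p).2 h), rfl⟩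
  refine ⟨s, hs, fun t ht x hx => ?_⟩
  have mem_colon {x y : R} : x ∈ A.colon {y} ↔ x * y ∈ A := by
    rw [Submodule.mem_colon_singleton, smul_eq_mul]
  have hts : t * s ∉ p := fun h => (hp.mem_or_mem h).elim ht hs
  rw [mul_comm, ← mem_colon]
  refine hmax ⟨_, hts, rfl⟩ (fun z hz => ?_) (mem_colon.2 ?_)
  · rw [mem_colon] at hz ⊢
    rw [mul_left_comm]
    exact A.mul_mem_left t hz
  · rw [← mul_assoc, mul_comm x t]
    exact A.mul_mem_right s hx

/-! ### The monoid of nonzero `r`-ideals -/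

namespace NonzeroRIdeal

variable [IsDomain R] {r : IdealSystem R}

theorem mul_mem_mul {I J : r.NonzeroRIdeal} {a b : R} (ha : a ∈ I.1) (hb : b ∈ J.1) :
    a * b ∈ (I * J).1 :=
  r.mem_cl (Set.mul_mem_mul ha hb)

theorem mul_le {I J : r.NonzeroRIdeal} {K : Ideal R} (hK : r.IsRIdeal K)
    (h : ∀ a ∈ I.1, ∀ b ∈ J.1, a * b ∈ K) : (I * J).1 ≤ K := by
  apply r.cl_le hK
  rintro _ ⟨a, ha, b, hb, rfl⟩
  exact h a ha b hb

theorem mul_le_left (I J : r.NonzeroRIdeal) : (I * J).1 ≤ I.1 :=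
  mul_le I.2.1 fun _ ha b _ => I.1.mul_mem_right b ha

theorem le_of_dvd {I J : r.NonzeroRIdeal} (h : I ∣ J) : J.1 ≤ I.1 := by
  obtain ⟨K, rfl⟩ := h
  exact mul_le_left I K

theorem eq_one_of_isUnit {I : r.NonzeroRIdeal} (h : IsUnit I) : I = 1 :=
  Subtype.ext (top_le_iff.1 (le_of_dvd h.dvd : (1 : r.NonzeroRIdeal).1 ≤ I.1))

theorem le_or_le_of_mul_le {p : Ideal R} (hp : p.IsPrime) {I J : r.NonzeroRIdeal}
    (h : (I * J).1 ≤ p) : I.1 ≤ p ∨ J.1 ≤ p := by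
  by_contra! hcon
  obtain ⟨a, ha, hap⟩ := SetLike.not_le_iff_exists.1 hcon.1
  obtain ⟨b, hb, hbp⟩ := SetLike.not_le_iff_exists.1 hcon.2
  exact (hp.mem_or_mem (h (mul_mem_mul ha hb))).elim hap hbp

/-- A nonzero `r`-ideal, as an element of the monoid of nonzero `r`-ideals. -/
def ofIsRIdeal {I : Ideal R} (hI : r.IsRIdeal I) (hI0 : I ≠ ⊥) : r.NonzeroRIdeal :=
  ⟨I, hI, hI0⟩

/-- A nonzero principal ideal, as an element of the monoid of nonzero `r`-ideals. -/
def principal (r : IdealSystem R) (a : R) (ha : a ≠ 0) : r.NonzeroRIdeal :=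
  ofIsRIdeal (r.isRIdeal_span_singleton a) (by simpa using ha)

theorem mem_principal_mul {a : R} (ha : a ≠ 0) (I : r.NonzeroRIdeal) {x : R} :
    x ∈ (principal r a ha * I).1 ↔ ∃ y ∈ I.1, x = a * y := by
  constructor
  · intro hx
    have hle : (principal r a ha * I).1 ≤ r.cl ((fun z => a * z) '' (I.1 : Set R)) := by
      refine mul_le (r.isRIdeal_cl _) fun b hb c hc => ?_
      obtain ⟨d, rfl⟩ := Ideal.mem_span_singleton.1 hb
      exact r.mem_cl ⟨d * c, I.1.mul_mem_left d hc, (mul_assoc a d c).symm⟩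
    have h : x ∈ (fun z => a * z) '' (r.cl (I.1 : Set R) : Set R) := by
      rw [r.mul_cl]
      exact hle hx
    obtain ⟨y, hy, rfl⟩ := h
    exact ⟨y, (congrArg (y ∈ ·) I.2.1).mp hy, rfl⟩
  · rintro ⟨y, hy, rfl⟩
    exact mul_mem_mul (Ideal.mem_span_singleton_self a) hy

theorem principal_mul_cancel {a : R} (ha : a ≠ 0) {I J : r.NonzeroRIdeal}
    (h : principal r a ha * I = principal r a ha * J) : I = J := by
  have key : ∀ I J : r.NonzeroRIdeal, principal r a ha * I = principal r a ha * J →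
      I.1 ≤ J.1 := by
    intro I J h x hx
    have hx' : a * x ∈ (principal r a ha * I).1 := (mem_principal_mul ha I).2 ⟨x, hx, rfl⟩
    rw [h] at hx'
    obtain ⟨y, hy, hxy⟩ := (mem_principal_mul ha J).1 hx'
    rwa [mul_left_cancel₀ ha hxy]
  exact Subtype.ext (le_antisymm (key I J h) (key J I h.symm))

theorem principal_dvd {a : R} (ha : a ≠ 0) {I : r.NonzeroRIdeal} (h : I.1 ≤ Ideal.span {a}) :
    principal r a ha ∣ I := by
  -- The cofactor is `(I : a)`, which equals `a⁻¹ I`.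
  have hle : I.1 ≤ I.1.colon {a} := fun x hx =>
    Submodule.mem_colon_singleton.2 (I.1.mul_mem_right a hx)
  refine ⟨ofIsRIdeal (isRIdeal_colon I.2.1 _) (ne_bot_of_le_ne_bot I.2.2 hle),
    Subtype.ext (SetLike.ext fun x => ?_)⟩
  rw [mem_principal_mul]
  constructor
  · intro hx
    obtain ⟨y, rfl⟩ := Ideal.mem_span_singleton.1 (h hx)
    refine ⟨y, Submodule.mem_colon_singleton.2 ?_, rfl⟩
    rwa [smul_eq_mul, mul_comm]
  · rintro ⟨y, hy, rfl⟩
    rw [mul_comm]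
    exact Submodule.mem_colon_singleton.1 hy

end NonzeroRIdeal

open NonzeroRIdeal

variable [IsDomain R] {r : IdealSystem R}

/-! ### Unit-cancellativity and atomicity -/

/-- If `I = (IJ)_r` with `J` contained in a height-one prime `p`, then every nonzero `r`-ideal `A`
satisfies `I ⊆ (AI)_r` locally at `p`. -/
theorem exists_mul_mem_mul_of_eq_mul (hr : r.IsRNoetherian) {p : Ideal R}
    (hp : p ∈ minimalNonzeroPrimes R) {I J : r.NonzeroRIdeal} (hIJ : I = I * J) (hJ : J.1 ≤ p)
    (A : r.NonzeroRIdeal) : ∃ s ∉ p, ∀ x ∈ I.1, s * x ∈ (A * I).1 := by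
  by_contra hA
  obtain ⟨A', ⟨hA'r, hA'0, hA'⟩, hmax⟩ := hr.exists_maximal
    (C := fun B => ∃ h : r.IsRIdeal B, ∃ h0 : B ≠ ⊥,
      ¬ ∃ s ∉ p, ∀ x ∈ I.1, s * x ∈ (ofIsRIdeal h h0 * I).1)
    (fun B hB => hB.1) ⟨A.2.1, A.2.2, hA⟩
  by_cases hAp : A' ≤ p
  · obtain ⟨y, hy⟩ := exists_mem_iff_mul_mem hr hA'r hA'0 hp hAp
    have hle : A' ≤ r.cl (insert y (A' : Set R)) := fun a ha => r.mem_cl (Or.inr ha)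
    have hB0 : r.cl (insert y (A' : Set R)) ≠ ⊥ := ne_bot_of_le_ne_bot hA'0 hle
    let B : r.NonzeroRIdeal := ofIsRIdeal (r.isRIdeal_cl _) hB0
    apply hA'
    by_cases hB : ∃ s ∉ p, ∀ x ∈ I.1, s * x ∈ (B * I).1
    · obtain ⟨s, hs, hsI⟩ := hB
      refine ⟨s, hs, fun x hx => ?_⟩
      -- `(BI)_r = (BJI)_r`, and `BJ ⊆ A'` because `yJ ⊆ yp ⊆ A'`.
      have hBJ : (B * J).1 ≤ A' := by
        refine mul_le hA'r fun b hb j hj => ?_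
        have hsub : r.cl (insert y (A' : Set R)) ≤ A'.colon {j} := by
          refine r.cl_le (isRIdeal_colon hA'r _) ?_
          rintro b (rfl | hb)
          · refine Submodule.mem_colon_singleton.2 ?_
            rw [smul_eq_mul, mul_comm]
            exact (hy j).1 (hJ hj)
          · exact Submodule.mem_colon_singleton.2 (A'.mul_mem_right j hb)
        exact Submodule.mem_colon_singleton.1 (hsub hb)
      have hmem := hsI x hx
      rw [show B * I = B * J * I by rw [mul_assoc, mul_comm J I, ← hIJ]] at hmem
      exact mul_le (isRIdeal_cl r _)
        (fun b hb i hi => mul_mem_mul (I := ofIsRIdeal hA'r hA'0) (hBJ hb) hi) hmem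
    · -- Otherwise maximality gives `y ∈ A'`, so that `1 ∈ p`.
      have hyA : y ∈ A' := hmax ⟨B.2.1, B.2.2, hB⟩ hle (r.mem_cl (Set.mem_insert _ _))
      exact absurd ((Ideal.eq_top_iff_one p).2 ((hy 1).2 (by rwa [one_mul]))) hp.1.1.ne_top
  · obtain ⟨s, hs, hsp⟩ := SetLike.not_le_iff_exists.1 hAp
    exact hA' ⟨s, hsp, fun x hx => mul_mem_mul (I := ofIsRIdeal hA'r hA'0) hs hx⟩

theorem eq_one_of_eq_mul (hconductor : completeConductor R ≠ ⊥) (hr : r.IsRNoetherian)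
    (hmax : r.rMax = minimalNonzeroPrimes R) {I J : r.NonzeroRIdeal} (hIJ : I = I * J) :
    J = 1 := by
  refine Subtype.ext (eq_top_of_forall_rMax hr J.2.1 J.2.2 fun p hp hJ => ?_)
  rw [hmax] at hp
  obtain ⟨f, hf, hf0⟩ := Submodule.exists_mem_ne_zero_of_ne_bot hconductor
  obtain ⟨c, hc, hc0⟩ := Submodule.exists_mem_ne_zero_of_ne_bot hp.1.2
  have hfc : f * c ≠ 0 := mul_ne_zero hf0 hc0
  obtain ⟨s, hs, hsI⟩ := exists_mul_mem_mul_of_eq_mul hr hp hIJ hJ (principal r (f * c) hfc)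
  have hdvd : f * c ∣ f * s := dvd_mul_of_mem_completeConductor I.2.2 hfc
    (fun x hx => (mem_principal_mul hfc I).1 (hsI x hx)) hf
  exact hs (p.mem_of_dvd ((mul_dvd_mul_iff_left hf0).1 hdvd) hc)

theorem closure_irreducible_eq_top (hconductor : completeConductor R ≠ ⊥)
    (hr : r.IsRNoetherian) (hmax : r.rMax = minimalNonzeroPrimes R) :
    Submonoid.closure {I : r.NonzeroRIdeal | Irreducible I} = ⊤ := by
  refine (Submonoid.eq_top_iff' _).2 fun I => ?_
  by_contra hI
  obtain ⟨B, ⟨hBr, hB0, hB⟩, hBmax⟩ := hr.exists_maximal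
    (C := fun B => ∃ h : r.IsRIdeal B, ∃ h0 : B ≠ ⊥, ofIsRIdeal h h0 ∉
      Submonoid.closure {I : r.NonzeroRIdeal | Irreducible I})
    (fun B hB => hB.1) ⟨I.2.1, I.2.2, hI⟩
  apply hB
  by_cases hirr : Irreducible (ofIsRIdeal hBr hB0)
  · exact Submonoid.subset_closure hirr
  by_cases hunit : IsUnit (ofIsRIdeal hBr hB0)
  · rw [eq_one_of_isUnit hunit]
    exact one_mem _
  rw [irreducible_iff] at hirr
  push Not at hirr
  obtain ⟨J, K, hJK, hJ, hK⟩ := hirr hunit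
  -- By unit-cancellativity, both factors are strictly larger than `B`.
  have key : ∀ J K : r.NonzeroRIdeal, ofIsRIdeal hBr hB0 = J * K →
      ¬ IsUnit K → J ∈ Submonoid.closure {I : r.NonzeroRIdeal | Irreducible I} := by
    intro J K hJK hK
    by_contra hJ
    have hle : B ≤ J.1 := le_of_dvd ⟨K, hJK⟩
    have hge : J.1 ≤ B := hBmax ⟨J.2.1, J.2.2, hJ⟩ hle
    have hBJ : ofIsRIdeal hBr hB0 = J := Subtype.ext (le_antisymm hle hge)
    rw [hBJ] at hJK
    exact hK (eq_one_of_eq_mul hconductor hr hmax hJK ▸ isUnit_one)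
  rw [hJK]
  exact mul_mem (key J K hJK hK) (key K J (hJK.trans (mul_comm J K)) hJ)

/-! ### Height-one primes not containing the conductor -/

/-- A height-one prime `p` not containing the conductor becomes principal after localization
at `p`. -/
theorem exists_mul_mem_span_of_mem_regularPrimes (hr : r.IsRNoetherian) {p : Ideal R}
    (hp : p ∈ regularPrimes R) :
    ∃ π ∈ p, π ≠ 0 ∧ ∃ b ∉ p, ∀ z ∈ p, b * z ∈ Ideal.span {π} := by
  obtain ⟨hp1, hcond⟩ := hp
  obtain ⟨f, hf, hfp⟩ := SetLike.not_le_iff_exists.1 hcond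
  obtain ⟨a, ha, ha0⟩ := Submodule.exists_mem_ne_zero_of_ne_bot hp1.1.2
  obtain ⟨y, hy⟩ := exists_mem_iff_mul_mem hr (r.isRIdeal_span_singleton a)
    (by simpa using ha0) hp1 ((Ideal.span_singleton_le_iff_mem p).2 ha)
  -- The multiplier `y / a` maps `p` into `R`; it cannot map `p` into `p`, since otherwise `f`
  -- would lie in `(aR : y) = p`.
  have hnot : ¬ ∀ x ∈ p, ∃ z ∈ p, y * x = a * z := fun h =>
    hfp ((hy f).2 (Ideal.mem_span_singleton.2
      (dvd_mul_of_mem_completeConductor hp1.1.2 ha0 h hf)))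
  push Not at hnot
  obtain ⟨π, hπ, hπ'⟩ := hnot
  obtain ⟨b, hb⟩ := Ideal.mem_span_singleton.1 ((hy π).1 hπ)
  have hbp : b ∉ p := fun h => hπ' b h (by rw [mul_comm, hb])
  refine ⟨π, hπ, ?_, b, hbp, fun z hz => ?_⟩
  · rintro rfl
    rw [zero_mul] at hb
    exact hbp ((mul_eq_zero.1 hb.symm).resolve_left ha0 ▸ p.zero_mem)
  · obtain ⟨w, hw⟩ := Ideal.mem_span_singleton.1 ((hy z).1 hz)
    refine Ideal.mem_span_singleton.2 ⟨w, mul_left_cancel₀ ha0 ?_⟩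
    calc a * (b * z) = a * b * z := by ring
      _ = z * y * π := by rw [← hb]; ring
      _ = a * (π * w) := by rw [hw]; ring

/-- A height-one prime not containing the conductor divides a nonzero principal ideal, that is,
it is `r`-invertible. -/
theorem exists_mul_eq_principal (hr : r.IsRNoetherian)
    (hmax : r.rMax = minimalNonzeroPrimes R) {P : r.NonzeroRIdeal}
    (hP : P.1 ∈ regularPrimes R) :
    ∃ (J : r.NonzeroRIdeal) (a : R) (ha : a ≠ 0), P * J = principal r a ha := by
  obtain ⟨π, hπ, hπ0, b, hb, hbπ⟩ := exists_mul_mem_span_of_mem_regularPrimes hr hP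
  have mem_colon {x : R} : x ∈ (Ideal.span {π}).colon (P.1 : Set R) ↔
      ∀ z ∈ P.1, x * z ∈ Ideal.span {π} := by
    simp [Submodule.mem_colon]
  have hπJ : π ∈ (Ideal.span {π}).colon (P.1 : Set R) :=
    mem_colon.2 fun z _ => Ideal.mul_mem_right z _ (Ideal.mem_span_singleton_self π)
  let J : r.NonzeroRIdeal := ofIsRIdeal
    (isRIdeal_colon (r.isRIdeal_span_singleton π) (P.1 : Set R))
    ((Submodule.ne_bot_iff _).2 ⟨π, hπJ, hπ0⟩)
  have hle : (P * J).1 ≤ Ideal.span {π} :=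
    mul_le (r.isRIdeal_span_singleton π) fun z hz x hx => by
      rw [mul_comm]
      exact mem_colon.1 hx z hz
  obtain ⟨L, hL⟩ := principal_dvd hπ0 hle
  have mem_L : ∀ z ∈ P.1, ∀ x ∈ J.1, ∀ w, z * x = π * w → w ∈ L.1 := by
    intro z hz x hx w hw
    have h : z * x ∈ (P * J).1 := mul_mem_mul hz hx
    rw [hL] at h
    obtain ⟨v, hv, hv'⟩ := (mem_principal_mul hπ0 L).1 h
    rwa [mul_left_cancel₀ hπ0 (hw.symm.trans hv')]
  have hL1 : L = 1 := by
    refine Subtype.ext (eq_top_of_forall_rMax hr L.2.1 L.2.2 fun q hq hLq => ?_)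
    rw [hmax] at hq
    by_cases hPq : P.1 ≤ q
    · -- At `q = p`, the product `π b` shows `b ∈ L`.
      rw [← eq_of_le_of_mem_minimalNonzeroPrimes hP.1 hq hPq] at hLq
      exact hb (hLq (mem_L π hπ b (mem_colon.2 hbπ) b rfl))
    · obtain ⟨z, hz, hzq⟩ := SetLike.not_le_iff_exists.1 hPq
      exact hzq (hLq (mem_L z hz π hπJ z (mul_comm z π)))
  exact ⟨J, π, hπ0, by rw [hL, hL1, mul_one]⟩

theorem mul_left_cancel_of_mem_regularPrimes (hr : r.IsRNoetherian)
    (hmax : r.rMax = minimalNonzeroPrimes R) {P : r.NonzeroRIdeal}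
    (hP : P.1 ∈ regularPrimes R) {A B : r.NonzeroRIdeal} (h : P * A = P * B) : A = B := by
  obtain ⟨J, a, ha, hJ⟩ := exists_mul_eq_principal hr hmax hP
  refine principal_mul_cancel ha ?_
  rw [← hJ, mul_comm P J, mul_assoc, mul_assoc, h]

theorem dvd_iff_le_of_mem_regularPrimes (hr : r.IsRNoetherian)
    (hmax : r.rMax = minimalNonzeroPrimes R) {P : r.NonzeroRIdeal}
    (hP : P.1 ∈ regularPrimes R) {A : r.NonzeroRIdeal} : P ∣ A ↔ A.1 ≤ P.1 := by
  refine ⟨le_of_dvd, fun h => ?_⟩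
  obtain ⟨J, a, ha, hJ⟩ := exists_mul_eq_principal hr hmax hP
  have hle : (A * J).1 ≤ Ideal.span {a} := by
    have hPJ : (P * J).1 = Ideal.span {a} := by rw [hJ]; rfl
    rw [← hPJ]
    exact mul_le (isRIdeal_cl r _) fun x hx y hy => mul_mem_mul (h hx) hy
  obtain ⟨C, hC⟩ := principal_dvd ha hle
  refine ⟨C, principal_mul_cancel ha ?_⟩
  calc principal r a ha * A = P * (A * J) := by rw [← hJ, mul_assoc, mul_comm J A]
    _ = principal r a ha * (P * C) := by rw [hC, mul_left_comm]

/-! ### Atoms -/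

/-- An atom contained in a height-one prime `p` coincides with its `p`-primary component. -/
theorem radical_eq_of_irreducible (hr : r.IsRNoetherian)
    (hmax : r.rMax = minimalNonzeroPrimes R) {I : r.NonzeroRIdeal} (hI : Irreducible I)
    {p : Ideal R} (hp : p ∈ minimalNonzeroPrimes R) (hIp : I.1 ≤ p) : I.1.radical = p := by
  have hpp : p.IsPrime := hp.1.1
  obtain ⟨s, hs, hsI⟩ := exists_forall_mul_mem hr I.2.1 hpp
  have mem_colon {x : R} : x ∈ I.1.colon {s} ↔ s * x ∈ I.1 := by
    rw [Submodule.mem_colon_singleton, smul_eq_mul, mul_comm]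
  have hIQ : I.1 ≤ I.1.colon {s} := fun x hx => mem_colon.2 (I.1.mul_mem_left s hx)
  let Q : r.NonzeroRIdeal := ofIsRIdeal (isRIdeal_colon I.2.1 {s})
    (ne_bot_of_le_ne_bot I.2.2 hIQ)
  have hQp : Q.1 ≤ p := fun x hx => (hpp.mem_or_mem (hIp (mem_colon.1 hx))).resolve_left hs
  -- As `p` is a minimal nonzero prime, the elements of `p` are nilpotent modulo `I` at `p`.
  have hpow : ∀ z ∈ p, ∃ n : ℕ, z ^ n ∈ Q.1 := by
    intro z hz
    by_contra! hcon
    have hdisj : Disjoint (I.1 : Set R) (p.primeCompl ⊔ Submonoid.powers z : Submonoid R) := by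
      rw [Set.disjoint_left]
      intro x hx hx'
      obtain ⟨t, ht, _, ⟨n, rfl⟩, rfl⟩ := Submonoid.mem_sup.1 hx'
      exact hcon n (mem_colon.2 (hsI t ht _ hx))
    obtain ⟨q, hq, hIq, hqd⟩ := Ideal.exists_le_prime_disjoint _ _ hdisj
    have hqp : q ≤ p := by
      intro x hx
      by_contra hxp
      exact Set.disjoint_left.1 hqd hx ((le_sup_left : p.primeCompl ≤ _) hxp)
    have hq0 : q ≠ ⊥ := ne_bot_of_le_ne_bot I.2.2 hIq
    exact Set.disjoint_left.1 hqd (hp.2 ⟨hq, hq0⟩ hqp hz)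
      ((le_sup_right : Submonoid.powers z ≤ _) (Submonoid.mem_powers z))
  have mem_colon_Q {x : R} : x ∈ I.1.colon (Q.1 : Set R) ↔ ∀ z ∈ Q.1, x * z ∈ I.1 := by
    simp [Submodule.mem_colon]
  have hsC : s ∈ I.1.colon (Q.1 : Set R) := mem_colon_Q.2 fun z hz => mem_colon.1 hz
  have hIC : I.1 ≤ I.1.colon (Q.1 : Set R) := fun x hx =>
    mem_colon_Q.2 fun z _ => I.1.mul_mem_right z hx
  let C : r.NonzeroRIdeal := ofIsRIdeal (isRIdeal_colon I.2.1 (Q.1 : Set R))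
    (ne_bot_of_le_ne_bot I.2.2 hIC)
  have hQC : I = Q * C := by
    refine Subtype.ext (le_antisymm (fun x hx => ?_) (mul_le I.2.1 fun z hz c hc => ?_))
    · -- The `r`-ideal `(QC : x)` contains `s ∉ p` and `Q`, so it lies in no height-one prime.
      have hQCr : r.IsRIdeal (Q * C).1 := (Q * C).2.1
      have hle : Q.1 ≤ (Q * C).1.colon {x} := fun z hz =>
        Submodule.mem_colon_singleton.2 (mul_mem_mul hz (hIC hx))
      have htop : (Q * C).1.colon {x} = ⊤ := by
        refine eq_top_of_forall_rMax hr (isRIdeal_colon hQCr _)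
          (ne_bot_of_le_ne_bot Q.2.2 hle) fun q hq hcon => ?_
        rw [hmax] at hq
        have hpq : p ≤ q := fun z hz => by
          obtain ⟨n, hn⟩ := hpow z hz
          exact hq.1.1.mem_of_pow_mem n (hcon (hle hn))
        rw [← eq_of_le_of_mem_minimalNonzeroPrimes hp hq hpq] at hcon
        refine hs (hcon (Submodule.mem_colon_singleton.2 ?_))
        rw [smul_eq_mul, mul_comm s x]
        exact mul_mem_mul (I := Q) (J := C) (hIQ hx) hsC
      have h1 : (1 : R) ∈ (Q * C).1.colon {x} := htop ▸ Submodule.mem_top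
      simpa using h1
    · rw [mul_comm]
      exact mem_colon_Q.1 hc z hz
  have hIeq : I = Q := by
    rcases hI.isUnit_or_isUnit hQC with h | h
    · refine absurd (top_le_iff.1 (?_ : ⊤ ≤ p)) hpp.ne_top
      rw [eq_one_of_isUnit h] at hQp
      exact hQp
    · rw [hQC, eq_one_of_isUnit h, mul_one]
  refine le_antisymm (hpp.radical_le_iff.2 hIp) fun z hz => ?_
  rw [hIeq]
  exact hpow z hz

theorem radical_mem_of_irreducible (hr : r.IsRNoetherian)
    (hmax : r.rMax = minimalNonzeroPrimes R) {I : r.NonzeroRIdeal} (hI : Irreducible I) :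
    I.1.radical ∈ minimalNonzeroPrimes R := by
  by_contra hcon
  refine hI.not_isUnit ?_
  have h1 : I = 1 := by
    refine Subtype.ext (eq_top_of_forall_rMax hr I.2.1 I.2.2 fun p hp hIp => ?_)
    rw [hmax] at hp
    exact hcon (radical_eq_of_irreducible hr hmax hI hp hIp ▸ hp)
  exact h1 ▸ isUnit_one

theorem mem_regularPrimes_or_mem_singularAtoms (hr : r.IsRNoetherian)
    (hmax : r.rMax = minimalNonzeroPrimes R) {I : r.NonzeroRIdeal} (hI : Irreducible I) :
    I.1 ∈ regularPrimes R ∨ I ∈ r.singularAtoms := by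
  have hrad := radical_mem_of_irreducible hr hmax hI
  by_cases hreg : I.1.radical ∈ regularPrimes R
  · left
    let P : r.NonzeroRIdeal :=
      ofIsRIdeal (isRIdeal_of_mem_minimalNonzeroPrimes hmax hrad) hrad.1.2
    -- The radical divides the atom `I`, and it is not the unit ideal.
    obtain ⟨C, hC⟩ := (dvd_iff_le_of_mem_regularPrimes (P := P) hr hmax hreg).2 Ideal.le_radical
    rcases hI.isUnit_or_isUnit hC with h | h
    · exact absurd (congrArg Subtype.val (eq_one_of_isUnit h)) hrad.1.1.ne_top
    · rw [eq_one_of_isUnit h, mul_one] at hC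
      have hIP : I.1 = I.1.radical := congrArg Subtype.val hC
      rwa [hIP]
  · exact Or.inr ⟨hI, hrad, hreg⟩

theorem not_le_of_mem_singularPart {p : Ideal R} (hp : p ∈ regularPrimes R)
    {I : r.NonzeroRIdeal} (hI : I ∈ r.singularPart) : ¬ I.1 ≤ p := by
  induction hI using Submonoid.closure_induction with
  | mem I hI =>
    intro hle
    have h := eq_of_le_of_mem_minimalNonzeroPrimes hI.2.1 hp.1
      (hp.1.1.1.radical_le_iff.2 hle)
    exact hI.2.2 (h ▸ hp)
  | one => exact fun h => hp.1.1.1.ne_top (top_le_iff.1 h)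
  | mul I J _ _ ihI ihJ =>
    exact fun h => (le_or_le_of_mul_le hp.1.1.1 h).elim ihI ihJ

theorem isUnit_iff_eq_one_singularPart {u : r.singularPart} : IsUnit u ↔ u = 1 :=
  ⟨fun h => Subtype.ext (eq_one_of_isUnit (h.map r.singularPart.subtype)),
    fun h => h ▸ isUnit_one⟩

theorem irreducible_singularPart {I : r.NonzeroRIdeal} (hI : Irreducible I)
    (hIT : I ∈ r.singularPart) : Irreducible (⟨I, hIT⟩ : r.singularPart) := by
  refine ⟨fun h => hI.not_isUnit (h.map r.singularPart.subtype), fun a b hab => ?_⟩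
  have h : I = a.1 * b.1 := congrArg Subtype.val hab
  rw [isUnit_iff_eq_one_singularPart, isUnit_iff_eq_one_singularPart]
  exact (hI.isUnit_or_isUnit h).imp (fun h => Subtype.ext (eq_one_of_isUnit h))
    fun h => Subtype.ext (eq_one_of_isUnit h)

/-! ### The decomposition -/

theorem isUnitCancellative_singularPart (hconductor : completeConductor R ≠ ⊥)
    (hr : r.IsRNoetherian) (hmax : r.rMax = minimalNonzeroPrimes R) :
    IsUnitCancellative r.singularPart := fun _ _ h =>
  isUnit_iff_eq_one_singularPart.2
    (Subtype.ext (eq_one_of_eq_mul hconductor hr hmax (congrArg Subtype.val h)))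

theorem nonempty_mulEquiv_singularPart (hconductor : completeConductor R ≠ ⊥)
    (hr : r.IsRNoetherian) (hmax : r.rMax = minimalNonzeroPrimes R) :
    Nonempty (r.NonzeroRIdeal ≃*
      Multiplicative (regularPrimes R →₀ ℕ) × r.singularPart) := by
  classical
  let e : regularPrimes R → r.NonzeroRIdeal := fun p =>
    ofIsRIdeal (isRIdeal_of_mem_minimalNonzeroPrimes hmax p.2.1) p.2.1.1.2
  have hdvd (p : regularPrimes R) {A : r.NonzeroRIdeal} : e p ∣ A ↔ A.1 ≤ p.1 :=
    dvd_iff_le_of_mem_regularPrimes (P := e p) hr hmax p.2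
  let φ : Multiplicative (regularPrimes R →₀ ℕ) × r.singularPart →* r.NonzeroRIdeal :=
    { toFun := fun x => ((Finsupp.toMultiset x.1.toAdd).map e).prod * (x.2 : r.NonzeroRIdeal)
      map_one' := by simp
      map_mul' := fun x y => by
        simp only [Prod.fst_mul, Prod.snd_mul, toAdd_mul, map_add, Multiset.map_add,
          Multiset.prod_add, Submonoid.coe_mul]
        exact mul_mul_mul_comm _ _ _ _ }
  have hinj : Function.Injective φ := by
    intro x y hxy
    have h := Multiset.injective_prod_map_mul e r.singularPart
      (fun p A B => mul_left_cancel_of_mem_regularPrimes (P := e p) hr hmax p.2)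
      (fun p A B h => by
        rw [hdvd] at h ⊢
        rw [hdvd]
        exact le_or_le_of_mul_le p.2.1.1.1 h)
      (fun p q h => (Subtype.ext
        (eq_of_le_of_mem_minimalNonzeroPrimes q.2.1 p.2.1 ((hdvd p).1 h))).symm)
      (fun p t ht h => not_le_of_mem_singularPart p.2 ht ((hdvd p).1 h))
      (a₁ := (Finsupp.toMultiset x.1.toAdd, x.2)) (a₂ := (Finsupp.toMultiset y.1.toAdd, y.2)) hxy
    rw [Prod.mk.injEq] at h
    exact Prod.ext (Multiplicative.toAdd.injective (Multiset.toFinsupp.symm.injective h.1)) h.2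
  have hsurj : Function.Surjective φ := by
    rw [← MonoidHom.mrange_eq_top, ← top_le_iff, ← closure_irreducible_eq_top hconductor hr hmax,
      Submonoid.closure_le]
    intro I hI
    rcases mem_regularPrimes_or_mem_singularAtoms hr hmax hI with h | h
    · refine ⟨(Multiplicative.ofAdd (Finsupp.single ⟨I.1, h⟩ 1), 1), ?_⟩
      change (Multiset.map e (Finsupp.toMultiset (Finsupp.single _ 1))).prod * 1 = I
      rw [Finsupp.toMultiset_single, one_smul, Multiset.map_singleton, Multiset.prod_singleton,
        mul_one]
      rfl
    · refine ⟨(1, ⟨I, Submonoid.subset_closure h⟩), ?_⟩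
      simp [φ]
  exact ⟨(MulEquiv.ofBijective φ ⟨hinj, hsurj⟩).symm⟩

theorem fg_singularPart_iff : Monoid.FG r.singularPart ↔ r.singularAtoms.Finite := by
  constructor
  · intro h
    obtain ⟨S, hS⟩ := Monoid.fg_def.1 h
    refine (S.finite_toSet.image Subtype.val).subset fun I hI => ?_
    exact ⟨⟨I, Submonoid.subset_closure hI⟩, Irreducible.mem_of_closure_eq_top
      (fun u hu => isUnit_iff_eq_one_singularPart.1 hu) hS
      (irreducible_singularPart hI.1 _), rfl⟩
  · intro h
    exact (Monoid.fg_iff_submonoid_fg _).2 ((Submonoid.fg_iff _).2 ⟨_, rfl, h⟩)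

end IdealSystem

theorem theorem4p8 {R : Type*} [CommRing R] [IsDomain R]
    (hconductor : completeConductor R ≠ ⊥)
    (r : IdealSystem R) (hnoeth : r.IsRNoetherian)
    (hmax : r.rMax = minimalNonzeroPrimes R) :
    (IsUnitCancellative r.singularPart ∧
      Nonempty (r.NonzeroRIdeal ≃*
        Multiplicative (regularPrimes R →₀ ℕ) × r.singularPart)) ∧
    (Monoid.FG r.singularPart ↔ r.singularAtoms.Finite) :=
  ⟨⟨IdealSystem.isUnitCancellative_singularPart hconductor hnoeth hmax,
    IdealSystem.nonempty_mulEquiv_singularPart hconductor hnoeth hmax⟩,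
    IdealSystem.fg_singularPart_iff⟩
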